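/- **Setting.** Let $(X,d)$ be a complete separable metric space. A Borel measure $m$ on $X$ (identified with its completion) is *Radon* if it is locally finite and inner regular with respect to compact sets. It is *quasi-Radon* if it is inner regular with respect to closed sets and every Borel set $A$ with $m(A)>0$ satisfies $m(A\cap U)>0$ for some open $U$ with $m(U)<\infty$. Let $\mathscr M^{qR}(X)$ be the set of quasi-Radon measures $m$ for which there is a closed set $S$ with empty interior and $m(S)=0$ such that, for every Borel neighbourhood $U$ of $S$, the restriction $m|_{X\setminus U}$ is Radon and finite on bounded sets. The *singular set* $\mathcal S_m$ is the set of points all of whose open neighbourhoods have infinite $m$-measure. A *pointed generalized metric measure space* is a tuple $\mathbb X=(X,d,m,\mathcal C,p)$ where $(X,d)$ is a complete separable length metric space, $0\neq m\in\mathscr M^{qR}(X)$, $\mathcal C\subset X$ is closed with empty interior and $m(\mathcal C)=0$, and $p\in\operatorname{supp}(m)$. Fix a Lipschitz function $f:[0,\infty)\to[0,1]$ with $f=1$ on $[0,1]$ and $f=0$ on $[2,\infty)$, and a continuous, concave, non-constant function $c:[0,\infty)\to\mathbb R$ with $c(0)=0$ and a finite limit at $\infty$. For $k\in\mathbb N$,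 the $k$-cut of $\mathbb X$ is $\mathbb X^k=(X,d,m^k,\mathcal C,p)$, where $m^k=f^k m$ and $$f^k(x)=f\big(2^{-k}d(x,p)\big)\,\big(1-f(2^k d(x,\mathcal S_m))\big)\ \text{ if }\mathcal S_m\ne\emptyset,\qquad f^k(x)=f\big(2^{-k}d(x,p)\big)\ \text{ if }\mathcal S_m=\emptyset .$$ For $\bar k\in\mathbb N$, let $\mathcal M^{qR}_{\bar k}$ be the class of pointed generalized metric measure spaces with $m^{\bar k}(X)>0$. For Borel probability measures $\mu,\nu$ on a complete separable metric space $(Z,d_Z)$ put $W_c(\mu,\nu)=\inf_\gamma\int c(d_Z(x,y))\,d\gamma(x,y)$, the infimum being over all couplings $\gamma$ of $\mu$ and $\nu$. Let $(d_Z)_H$ be the Hausdorff distance, with values in $[0,\infty]$, $(d_Z)_H(\emptyset,\emptyset)=0$, and $(d_Z)_H(\emptyset,A)=\infty$ for $A\neq\emptyset$. For finite nonzero $m$ write $\bar m=m/m(X)$. For spaces $\mathbb X_1,\mathbb X_2$ of finite positive mass define $$d^{fm}_{\mathsf{iKRW}}(\mathbb X_1,\mathbb X_2)=\Big|\log\frac{m_1(X_1)}{m_2(X_2)}\Big|+\inf\Big\{d_Z(i_1(p_1),i_2(p_2))+(d_Z)_H(i_1(\mathcal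 C_1),i_2(\mathcal C_2))+W_c\big((i_1)_\sharp\bar m_1,(i_2)_\sharp\bar m_2\big)\Big\},$$ the infimum being over all isometric embeddings $i_1,i_2$ of $X_1,X_2$ into a common complete separable metric space $(Z,d_Z)$. For $\mathbb X_1,\mathbb X_2\in\mathcal M^{qR}_{\bar k}$ define $$d_{\mathsf{iKRW}}(\mathbb X_1,\mathbb X_2)=\sum_{k\ge\bar k}2^{-k}\min\{1,d^{fm}_{\mathsf{iKRW}}(\mathbb X_1^k,\mathbb X_2^k)\}.$$ **Proposition.** Let $\bar k\in\mathbb N$ and let $\mathbb X_n=(X_n,d_n,m_n,\mathcal S_{m_n},p_n)\in\mathcal M^{qR}_{\bar k}$ for $n\in\mathbb N\cup\{\infty\}$, so that the distinguished closed set of each space is its singular set. The following are equivalent: 1. $\lim_{n\to\infty}d_{\mathsf{iKRW}}(\mathbb X_n,\mathbb X_\infty)=0$; 2. there are a complete separable metric space $(Z,d_Z)$ and isometric embeddings $i_n:X_n\to Z$, $n\in\mathbb N\cup\{\infty\}$ (an *effective realization* of the convergence), such that for every $k\ge\bar k$ $$\Big|\log\frac{m_n^k(X_n)}{m_\infty^k(X_\infty)}\Big|+d_Z\big(i_n(p_n),i_\infty(p_\infty)\big)+(d_Z)_H\big(i_n(\mathcal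 S_{m_n}),i_\infty(\mathcal S_{m_\infty})\big)+W_c\big((i_n)_\sharp\bar m_n^k,(i_\infty)_\sharp\bar m_\infty^k\big)\xrightarrow[n\to\infty]{}0 .$$ -/

import Mathlib

open MeasureTheory Set Filter Topology
open scoped ENNReal

universe u

noncomputable section

/-! ### Quasi-Radon measures

Measures are Mathlib measures on the Borel `σ`-algebra. Such a measure is evaluated on every subset
through its outer extension, so it carries the same data as its completion. -/

section Measures

variable {X : Type u} [MetricSpace X] [MeasurableSpace X]

/-- Every measurable set of positive measure meets some open set of finite measure in a set of
positive measure. -/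
def EffectivelyLocallyFinite (m : Measure X) : Prop :=
  ∀ A : Set X, MeasurableSet A → 0 < m A → ∃ U : Set X, IsOpen U ∧ m U < ∞ ∧ 0 < m (A ∩ U)

/-- Radon measures: locally finite and inner regular with respect to compact sets. -/
def IsRadonMeasure (m : Measure X) : Prop :=
  IsLocallyFiniteMeasure m ∧ m.InnerRegularWRT IsCompact MeasurableSet

/-- Quasi-Radon measures: effectively locally finite and inner regular with respect to closed
sets. -/
def IsQuasiRadon (m : Measure X) : Prop :=
  EffectivelyLocallyFinite m ∧ m.InnerRegularWRT IsClosed MeasurableSet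

/-- The class `𝓜^R_loc(X)`: Radon measures that are finite on bounded sets. -/
def MemRadonLoc (m : Measure X) : Prop :=
  IsRadonMeasure m ∧ ∀ B : Set X, Bornology.IsBounded B → m B < ∞

/-- The class `𝓜_S(X)`: quasi-Radon measures for which `S` is null and whose restriction to the
complement of every Borel neighbourhood of `S` belongs to `𝓜^R_loc(X)`. -/
def MemAwayFrom (S : Set X) (m : Measure X) : Prop :=
  IsQuasiRadon m ∧ m S = 0 ∧ ∀ U ∈ 𝓝ˢ S, MeasurableSet U → MemRadonLoc (m.restrict Uᶜ)

/-- The class `𝓜^{qR}(X)`. -/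
def MemQR (m : Measure X) : Prop :=
  IsQuasiRadon m ∧ ∃ S : Set X, IsClosed S ∧ interior S = ∅ ∧ MemAwayFrom S m

/-- The singular set of `m`: the points all of whose open neighbourhoods have infinite measure. -/
def singularSet (m : Measure X) : Set X :=
  {x | ∀ U : Set X, IsOpen U → x ∈ U → m U = ∞}

end Measures

/-- Length spaces: the distance of two points is the infimum of the lengths of the continuous curves
joining them. -/
def IsLengthSpace (X : Type u) [MetricSpace X] : Prop :=
  ∀ x y : X, edist x y = ⨅ γ : Path x y, eVariationOn γ univ

/-! ### Pointed generalized metric measure spaces -/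

/-- The data `(X, d, m, C, p)`: a complete separable metric space with a Borel measure, a
distinguished set and a base point. The conditions on `m`, `C` and `p` are imposed in
`PointedSpace.IsGeneralizedMMS`. -/
structure PointedSpace where
  carrier : Type u
  [metric : MetricSpace carrier]
  [complete : CompleteSpace carrier]
  [separable : TopologicalSpace.SeparableSpace carrier]
  [measurable : MeasurableSpace carrier]
  [borel : BorelSpace carrier]
  measure : Measure carrier
  distinguished : Set carrier
  base : carrier

instance : CoeSort PointedSpace.{u} (Type u) := ⟨PointedSpace.carrier⟩

attribute [instance] PointedSpace.metric PointedSpace.complete PointedSpace.separable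
  PointedSpace.measurable PointedSpace.borel

/-- Lipschitz cut-off functions on `[0, ∞)` with values in `[0, 1]`, equal to `1` on `[0, 1]` and to
`0` on `[2, ∞)`. -/
structure IsCutoff (f : ℝ → ℝ) : Prop where
  lipschitz : ∃ K, LipschitzOnWith K f (Ici 0)
  mem_Icc : ∀ x, 0 ≤ x → f x ∈ Icc (0 : ℝ) 1
  eq_one : ∀ x, 0 ≤ x → x ≤ 1 → f x = 1
  eq_zero : ∀ x, 2 ≤ x → f x = 0

/-- Cost functions: continuous, concave and non-constant on `[0, ∞)`, vanishing at `0`, with a finite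
limit at infinity. -/
structure IsCost (c : ℝ → ℝ) : Prop where
  continuousOn : ContinuousOn c (Ici 0)
  concaveOn : ConcaveOn ℝ (Ici 0) c
  zero : c 0 = 0
  nonconstant : ∃ x, 0 ≤ x ∧ c x ≠ 0
  limit : ∃ L : ℝ, Tendsto c atTop (𝓝 L)

/-- A cost function is nonnegative, so that `ENNReal.ofReal` loses nothing in `Wc` below. -/
theorem IsCost.nonneg {c : ℝ → ℝ} (hc : IsCost c) {x : ℝ} (hx : 0 ≤ x) : 0 ≤ c x := by
  by_contra! hneg
  obtain ⟨L, hL⟩ := hc.limit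
  have hx0 : 0 < x := lt_of_le_of_ne hx (by rintro rfl; simp [hc.zero] at hneg)
  have key : ∀ n : ℕ, 1 ≤ n → c (n * x) ≤ n * c x := by
    intro n hn
    have hn0 : (0 : ℝ) < n := by exact_mod_cast hn
    have hn1 : (1 : ℝ) ≤ n := by exact_mod_cast hn
    have h := hc.concaveOn.2 (mem_Ici.2 le_rfl) (mem_Ici.2 (mul_nonneg hn0.le hx))
      (sub_nonneg.2 (inv_le_one_of_one_le₀ hn1)) (inv_nonneg.2 hn0.le) (by ring)
    have e : (1 - (n : ℝ)⁻¹) • (0 : ℝ) + (n : ℝ)⁻¹ • ((n : ℝ) * x) = x := by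
      simp only [smul_eq_mul]; field_simp; ring
    rw [e, hc.zero, smul_zero, zero_add, smul_eq_mul, inv_mul_le_iff₀ hn0] at h
    exact h
  have h1 : Tendsto (fun n : ℕ => c (n * x)) atTop (𝓝 L) :=
    hL.comp (tendsto_natCast_atTop_atTop.atTop_mul_const hx0)
  have h2 : Tendsto (fun n : ℕ => (n : ℝ) * c x) atTop atBot :=
    tendsto_natCast_atTop_atTop.atTop_mul_const_of_neg hneg
  have h3 : Tendsto (fun n : ℕ => c (n * x)) atTop atBot :=
    tendsto_atBot_mono' atTop (eventually_atTop.2 ⟨1, key⟩) h2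
  exact not_tendsto_nhds_of_tendsto_atBot h3 L h1

namespace PointedSpace

/-- Pointed generalized metric measure spaces. -/
structure IsGeneralizedMMS (X : PointedSpace.{u}) : Prop where
  length : IsLengthSpace X
  memQR : MemQR X.measure
  measure_ne_zero : X.measure ≠ 0
  isClosed : IsClosed X.distinguished
  interior_eq_empty : interior X.distinguished = ∅
  measure_distinguished : X.measure X.distinguished = 0
  base_mem_support : X.base ∈ X.measure.support

open Classical in
/-- The density `f^k` of the `k`-th cut. -/
def cutDensity (f : ℝ → ℝ) (X : PointedSpace.{u}) (k : ℕ) (x : X) : ℝ :=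
  if (singularSet X.measure).Nonempty then
    f (dist x X.base / 2 ^ k) * (1 - f (Metric.infDist x (singularSet X.measure) * 2 ^ k))
  else f (dist x X.base / 2 ^ k)

/-- The `k`-th cut `(X, d, f^k m, C, p)`. -/
abbrev cut (f : ℝ → ℝ) (X : PointedSpace.{u}) (k : ℕ) : PointedSpace.{u} where
  carrier := X.carrier
  measure := X.measure.withDensity fun x => ENNReal.ofReal (X.cutDensity f k x)
  distinguished := X.distinguished
  base := X.base

/-- The normalization `m / m(X)` of the measure. -/
def normalized (X : PointedSpace.{u}) : Measure X :=
  (X.measure univ)⁻¹ • X.measure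

/-- The class `𝓜^{qR}_{k̄}` of pointed generalized metric measure spaces whose `k̄`-th cut has positive
mass. -/
def MemClass (f : ℝ → ℝ) (kbar : ℕ) (X : PointedSpace.{u}) : Prop :=
  X.IsGeneralizedMMS ∧ 0 < (X.cut f kbar).measure univ

/-- The distinguished set is the singular set. -/
def IsCanonical (X : PointedSpace.{u}) : Prop :=
  X.distinguished = singularSet X.measure

/-- `|log (m₁(X₁) / m₂(X₂))|`. -/
def logMassRatio (X₁ X₂ : PointedSpace.{u}) : ℝ≥0∞ :=
  ENNReal.ofReal |Real.log (X₁.measure univ / X₂.measure univ).toReal|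

end PointedSpace

/-! ### The distances -/

/-- The transport distance `W_c`: the infimum of the transport cost for the cost `c ∘ d` over all
couplings. -/
def Wc (c : ℝ → ℝ) {Z : Type u} [MetricSpace Z] [MeasurableSpace Z] (μ ν : Measure Z) : ℝ≥0∞ :=
  ⨅ (γ : Measure (Z × Z)) (_ : γ.map Prod.fst = μ ∧ γ.map Prod.snd = ν),
    ∫⁻ z, ENNReal.ofReal (c (dist z.1 z.2)) ∂γ

/-- `d_Z(i₁ p₁, i₂ p₂) + (d_Z)_H(i₁ C₁, i₂ C₂) + W_c(i₁♯ m̄₁, i₂♯ m̄₂)`. The Hausdorff distance is the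
extended one: `0` between two empty sets and `∞` between an empty and a nonempty set. -/
def embeddingCost (c : ℝ → ℝ) (X₁ X₂ : PointedSpace.{u}) {Z : Type u} [MetricSpace Z]
    [MeasurableSpace Z] (i₁ : X₁ → Z) (i₂ : X₂ → Z) : ℝ≥0∞ :=
  edist (i₁ X₁.base) (i₂ X₂.base)
    + Metric.hausdorffEDist (i₁ '' X₁.distinguished) (i₂ '' X₂.distinguished)
    + Wc c (X₁.normalized.map i₁) (X₂.normalized.map i₂)

/-- The distance `d^{fm}_{iKRW}` of spaces of finite positive mass: the infimum runs over all pairs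
of isometric embeddings into a common complete separable metric space. -/
def diKRWfm (c : ℝ → ℝ) (X₁ X₂ : PointedSpace.{u}) : ℝ≥0∞ :=
  X₁.logMassRatio X₂ +
    ⨅ (Z : Type u) (_ : MetricSpace Z) (_ : CompleteSpace Z) (_ : TopologicalSpace.SeparableSpace Z)
      (_ : MeasurableSpace Z) (_ : BorelSpace Z) (i₁ : X₁ → Z) (i₂ : X₂ → Z)
      (_ : Isometry i₁) (_ : Isometry i₂), embeddingCost c X₁ X₂ i₁ i₂

/-- The pointed distance `d_iKRW` with regularity parameter `k̄`. -/
def diKRW (f c : ℝ → ℝ) (kbar : ℕ) (X₁ X₂ : PointedSpace.{u}) : ℝ≥0∞ :=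
  ∑' k : {k : ℕ // kbar ≤ k},
    (2 ^ (k : ℕ))⁻¹ * min 1 (diKRWfm c (X₁.cut f k) (X₂.cut f k))

/-- A complete separable metric space `Z` and isometric embeddings `i n`, `iInf` form an effective
realization of the convergence of `X n` to `XInf`. Since a cut has the carrier, the distinguished set
and the base point of the original space, only the measures in the expression depend on `k`. -/
def IsEffectiveRealization (f c : ℝ → ℝ) (kbar : ℕ) (X : ℕ → PointedSpace.{u})
    (XInf : PointedSpace.{u}) {Z : Type u} [MetricSpace Z] [MeasurableSpace Z]
    (i : ∀ n, X n → Z) (iInf : XInf → Z) : Prop :=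
  (∀ n, Isometry (i n)) ∧ Isometry iInf ∧
    ∀ k, kbar ≤ k → Tendsto (fun n =>
      ((X n).cut f k).logMassRatio (XInf.cut f k)
        + edist (i n (X n).base) (iInf XInf.base)
        + Metric.hausdorffEDist (i n '' singularSet (X n).measure)
            (iInf '' singularSet XInf.measure)
        + Wc c (((X n).cut f k).normalized.map (i n)) ((XInf.cut f k).normalized.map iInf))
      atTop (𝓝 0)

end

/-! ### Cost functions -/

/-! Only the passage from convergence of the distances to one common space needs work. Since the
weights `2^{-k}` are summable, convergence of `diKRW` amounts to convergence of `diKRWfm` for the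
cuts at each level `k ≥ kbar` separately (`tendsto_diKRW_iff`). The embeddings that nearly realize
these distances may depend on both `n` and `k`, and both dependences must be removed.

The dependence on `k` is removed by showing that embeddings good for the `l`-cut are good for every
`k`-cut with `kbar ≤ k < l` (`exists_Wc_cut_le`). The density of the `l`-cut is `1` wherever that of
the `k`-cut is nonzero, so the `k`-cut is the `l`-cut times the `k`-th density. This density extends
to the ambient space, where it is Lipschitz in the point, the base point and, for the Hausdorff
distance, the singular set. A coupling of the normalized `l`-cuts is multiplied by the minimum of
the two normalized densities, and the small remaining mass is coupled arbitrarily, which is cheap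
because the cost is bounded. The resulting constant involves the limit space but not the
approximating one, hence is uniform in `n`. A diagonal choice then gives, for each `n`, embeddings
good for all levels below some `κ n → ∞` (`exists_extensions`).

The dependence on `n` is removed by gluing: each of these ambient spaces contains a copy of the
limit space, and amalgamating all of them along it gives one complete separable space
(`MetricExtension.exists_complete_separable`). -/

namespace IsCost

variable {c : ℝ → ℝ}

/-- Concavity on the chord from the origin, where the cost vanishes. -/
theorem mul_le_of_le (hc : IsCost c) {s t : ℝ} (hs : 0 ≤ s) (hst : s ≤ t) (ht : 0 < t) :
    s / t * c t ≤ c s := by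
  have h1 : s / t ≤ 1 := (div_le_one ht).2 hst
  have h := hc.concaveOn.2 (mem_Ici.2 le_rfl) (mem_Ici.2 ht.le) (sub_nonneg.2 h1)
    (div_nonneg hs ht.le) (by ring)
  simpa [hc.zero, div_mul_cancel₀ _ ht.ne'] using h

/-- A substitute for monotonicity: `t` is the midpoint of `s` and `2 * t - s`, and the cost is
nonnegative at the latter. -/
theorem le_two_mul (hc : IsCost c) {s t : ℝ} (hs : 0 ≤ s) (hst : s ≤ t) : c s ≤ 2 * c t := by
  have h := hc.concaveOn.2 (mem_Ici.2 hs) (mem_Ici.2 (by linarith : 0 ≤ 2 * t - s))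
    (by norm_num : (0 : ℝ) ≤ 1 / 2) (by norm_num : (0 : ℝ) ≤ 1 / 2) (by norm_num)
  have e : (1 / 2 : ℝ) • s + (1 / 2 : ℝ) • (2 * t - s) = t := by
    simp only [smul_eq_mul]; ring
  have := hc.nonneg (by linarith : 0 ≤ 2 * t - s)
  rw [e, smul_eq_mul, smul_eq_mul] at h
  linarith

theorem exists_bound (hc : IsCost c) : ∃ M : ℝ, 0 ≤ M ∧ ∀ t, 0 ≤ t → c t ≤ M := by
  obtain ⟨L, hL⟩ := hc.limit
  have hb : ∀ t, 0 ≤ t → c t ≤ 2 * L := fun t ht =>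
    ge_of_tendsto (hL.const_mul 2) (eventually_atTop.2 ⟨t, fun s hs => hc.le_two_mul ht hs⟩)
  exact ⟨2 * L, (hc.nonneg le_rfl).trans (hb 0 le_rfl), hb⟩

/-- Truncated multiples of the distance are controlled by the cost. -/
theorem exists_min_le (hc : IsCost c) (L : ℝ) (hL : 0 ≤ L) :
    ∃ C : ℝ, 0 ≤ C ∧ ∀ t, 0 ≤ t → min 1 (L * t) ≤ C * c t := by
  obtain ⟨r, hr, hcr⟩ := hc.nonconstant
  have hr0 : 0 < r := lt_of_le_of_ne hr (by rintro rfl; exact hcr hc.zero)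
  have hcr0 : 0 < c r := lt_of_le_of_ne (hc.nonneg hr) hcr.symm
  -- The summand `2` serves `t ≥ r`, where the minimum is at most `1` and `c r ≤ 2 * c t`. The
  -- summand `L * r` serves `t ≤ r`, where the chord bound makes `L * t` comparable to `c t`.
  refine ⟨(2 + L * r) / c r, by positivity, fun t ht => ?_⟩
  have hct := hc.nonneg ht
  rw [div_mul_eq_mul_div, le_div_iff₀ hcr0]
  rcases le_total r t with h | h
  · have h2 := hc.le_two_mul hr h
    have h3 : min 1 (L * t) * c r ≤ 1 * c r := by gcongr; exact min_le_left _ _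
    have : 0 ≤ L * r * c t := by positivity
    linarith
  · have h2 := hc.mul_le_of_le ht h hr0
    rw [div_mul_eq_mul_div, div_le_iff₀ hr0] at h2
    have h3 : min 1 (L * t) * c r ≤ L * t * c r := by gcongr; exact min_le_right _ _
    have h4 : L * (t * c r) ≤ L * (c t * r) := by gcongr
    linarith

end IsCost

theorem IsCost.measurable_cost {c : ℝ → ℝ} (hc : IsCost c) {Z : Type u} [MetricSpace Z]
    [TopologicalSpace.SeparableSpace Z] [MeasurableSpace Z] [BorelSpace Z] :
    Measurable fun z : Z × Z => ENNReal.ofReal (c (dist z.1 z.2)) := by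
  have : SecondCountableTopology Z := UniformSpace.secondCountable_of_separable Z
  have : Continuous fun z : Z × Z => c (dist z.1 z.2) :=
    hc.continuousOn.comp_continuous continuous_dist fun _ => dist_nonneg
  exact this.measurable.ennreal_ofReal

/-! ### Couplings -/

section Coupling

theorem map_withDensity_comp {α β : Type*} [MeasurableSpace α] [MeasurableSpace β] {μ : Measure α}
    {g : α → β} (hg : Measurable g) {φ : β → ℝ≥0∞} (hφ : Measurable φ) :
    (μ.withDensity (φ ∘ g)).map g = (μ.map g).withDensity φ := by
  ext s hs
  rw [Measure.map_apply hg hs, withDensity_apply _ (hg hs), withDensity_apply _ hs,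
    setLIntegral_map hs hφ hg]
  rfl

variable {Z : Type u} [MetricSpace Z] [MeasurableSpace Z]

/-- The transport cost between two probability measures with densities with respect to the marginals
of `γ` is at most the cost of the common part plus the diameter bound times the remaining mass. -/
theorem Wc_withDensity_le {c : ℝ → ℝ} {M : ℝ} (hM : ∀ t, 0 ≤ t → c t ≤ M)
    (γ : Measure (Z × Z)) [IsFiniteMeasure γ] {φ ψ : Z → ℝ≥0∞} (hφ : Measurable φ)
    (hψ : Measurable ψ) (hφ1 : ∫⁻ z, φ z.1 ∂γ = 1) (hψ1 : ∫⁻ z, ψ z.2 ∂γ = 1) :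
    Wc c ((γ.map Prod.fst).withDensity φ) ((γ.map Prod.snd).withDensity ψ) ≤
      ∫⁻ z, ENNReal.ofReal (c (dist z.1 z.2)) ∂γ.withDensity (fun z => min (φ z.1) (ψ z.2))
        + ENNReal.ofReal M * ∫⁻ z, (ψ z.2 - φ z.1) ∂γ := by
  set θ : Z × Z → ℝ≥0∞ := fun z => min (φ z.1) (ψ z.2)
  have hφ' : Measurable fun z : Z × Z => φ z.1 := hφ.comp measurable_fst
  have hψ' : Measurable fun z : Z × Z => ψ z.2 := hψ.comp measurable_snd
  have hθ : Measurable θ := hφ'.min hψ'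
  have hdφ : Measurable fun z : Z × Z => φ z.1 - ψ z.2 := hφ'.sub hψ'
  have hdψ : Measurable fun z : Z × Z => ψ z.2 - φ z.1 := hψ'.sub hφ'
  set r := ∫⁻ z, (ψ z.2 - φ z.1) ∂γ with hr
  have eφ : ∀ z : Z × Z, θ z + (φ z.1 - ψ z.2) = φ z.1 := fun z => by
    rw [add_comm]; exact tsub_add_min
  have eψ : ∀ z : Z × Z, θ z + (ψ z.2 - φ z.1) = ψ z.2 := fun z => by
    rw [add_comm, show θ z = min (ψ z.2) (φ z.1) from min_comm _ _]; exact tsub_add_min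
  have iφ : ∫⁻ z, θ z ∂γ + ∫⁻ z, (φ z.1 - ψ z.2) ∂γ = 1 := by
    rw [← lintegral_add_left hθ, ← hφ1]; simp_rw [eφ]
  have iψ : ∫⁻ z, θ z ∂γ + r = 1 := by
    rw [hr, ← lintegral_add_left hθ, ← hψ1]; simp_rw [eψ]
  have hθtop : ∫⁻ z, θ z ∂γ ≠ ∞ := ne_top_of_le_ne_top ENNReal.one_ne_top (iφ ▸ le_self_add)
  have hrtop : r ≠ ∞ := ne_top_of_le_ne_top ENNReal.one_ne_top (iψ ▸ le_add_self)
  -- Both densities have total mass `1`, so the two excesses over the common part have equal mass.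
  have hrφ : ∫⁻ z, (φ z.1 - ψ z.2) ∂γ = r := (ENNReal.add_right_inj hθtop).1 (iφ.trans iψ.symm)
  set α := (γ.withDensity fun z => φ z.1 - ψ z.2).map Prod.fst with hα
  set β := (γ.withDensity fun z => ψ z.2 - φ z.1).map Prod.snd with hβ
  have hαu : α univ = r := by
    rw [hα, Measure.map_apply measurable_fst MeasurableSet.univ, preimage_univ,
      withDensity_apply _ MeasurableSet.univ, Measure.restrict_univ, hrφ]
  have hβu : β univ = r := by
    rw [hβ, Measure.map_apply measurable_snd MeasurableSet.univ, preimage_univ,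
      withDensity_apply _ MeasurableSet.univ, Measure.restrict_univ]
  have : IsFiniteMeasure α := ⟨by rw [hαu]; exact hrtop.lt_top⟩
  have : IsFiniteMeasure β := ⟨by rw [hβu]; exact hrtop.lt_top⟩
  -- If `r = 0`, then `r⁻¹ = ∞`, but the leftover measures vanish and the identity survives.
  have hscale : ∀ κ : Measure Z, κ univ = r → r⁻¹ • (r • κ) = κ := by
    intro κ hκ
    rcases eq_or_ne r 0 with h0 | h0
    · rw [h0, Measure.measure_univ_eq_zero] at hκ
      simp [hκ]
    · rw [smul_smul, ENNReal.inv_mul_cancel h0 hrtop, one_smul]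
  -- The common part moves along `γ`; the leftover marginals are coupled by their product, rescaled
  -- to mass `r`.
  set π := γ.withDensity θ + r⁻¹ • α.prod β
  have hfst : π.map Prod.fst = (γ.map Prod.fst).withDensity φ := by
    rw [Measure.map_add _ _ measurable_fst, Measure.map_smul]
    have : (α.prod β).map Prod.fst = r • α := by rw [Measure.map_fst_prod, hβu]
    rw [this, hscale α hαu, hα, ← Measure.map_add _ _ measurable_fst,
      ← withDensity_add_left hθ, ← map_withDensity_comp measurable_fst hφ]
    congr 2
    funext z
    exact eφ z
  have hsnd : π.map Prod.snd = (γ.map Prod.snd).withDensity ψ := by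
    rw [Measure.map_add _ _ measurable_snd, Measure.map_smul]
    have : (α.prod β).map Prod.snd = r • β := by rw [Measure.map_snd_prod, hαu]
    rw [this, hscale β hβu, hβ, ← Measure.map_add _ _ measurable_snd,
      ← withDensity_add_left hθ, ← map_withDensity_comp measurable_snd hψ]
    congr 2
    funext z
    exact eψ z
  refine (iInf₂_le π ⟨hfst, hsnd⟩).trans ?_
  rw [lintegral_add_measure, lintegral_smul_measure]
  gcongr
  calc r⁻¹ • ∫⁻ z, ENNReal.ofReal (c (dist z.1 z.2)) ∂α.prod β
      ≤ r⁻¹ * ∫⁻ _, ENNReal.ofReal M ∂α.prod β := by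
        rw [smul_eq_mul]
        gcongr with z
        exact hM _ dist_nonneg
    _ = ENNReal.ofReal M * (r⁻¹ * (r * r)) := by
        rw [lintegral_const, ← univ_prod_univ, Measure.prod_prod, hαu, hβu]; ring
    _ ≤ ENNReal.ofReal M * r := by
        gcongr
        rw [← mul_assoc]
        exact mul_le_of_le_one_left zero_le (ENNReal.inv_mul_le_one r)

/-- The normalization of a measure. -/
noncomputable def normalizedMeasure {α : Type*} [MeasurableSpace α] (μ : Measure α) : Measure α :=
  (μ univ)⁻¹ • μ

/-- Stability of the transport cost under multiplication with densities. -/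
theorem Wc_normalizedMeasure_withDensity_le {c : ℝ → ℝ} {M : ℝ} (hM : ∀ t, 0 ≤ t → c t ≤ M)
    (γ : Measure (Z × Z)) [IsFiniteMeasure γ] {φ ψ : Z → ℝ≥0∞} (hφ : Measurable φ)
    (hψ : Measurable ψ) (hψ1 : ∀ z, ψ z ≤ 1)
    (hφ0 : ∫⁻ z, φ z.1 ∂γ ≠ 0) (hφt : ∫⁻ z, φ z.1 ∂γ ≠ ∞)
    (hψ0 : ∫⁻ z, ψ z.2 ∂γ ≠ 0) (hψt : ∫⁻ z, ψ z.2 ∂γ ≠ ∞)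
    {δ : Z × Z → ℝ≥0∞} (hδ : ∀ z, φ z.1 ≤ ψ z.2 + δ z) (hδ' : ∀ z, ψ z.2 ≤ φ z.1 + δ z)
    (hδm : Measurable δ) :
    Wc c (normalizedMeasure ((γ.map Prod.fst).withDensity φ))
        (normalizedMeasure ((γ.map Prod.snd).withDensity ψ)) ≤
      (∫⁻ z, ψ z.2 ∂γ)⁻¹ * (∫⁻ z, ENNReal.ofReal (c (dist z.1 z.2)) ∂γ
        + 2 * ENNReal.ofReal M * ∫⁻ z, δ z ∂γ) := by
  set a := ∫⁻ z, φ z.1 ∂γ with ha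
  set b := ∫⁻ z, ψ z.2 ∂γ with hb
  set D := ∫⁻ z, δ z ∂γ with hD
  have hφ' : Measurable fun z : Z × Z => φ z.1 := hφ.comp measurable_fst
  have hψ' : Measurable fun z : Z × Z => ψ z.2 := hψ.comp measurable_snd
  have e1 : normalizedMeasure ((γ.map Prod.fst).withDensity φ) =
      (γ.map Prod.fst).withDensity fun z => a⁻¹ * φ z := by
    rw [normalizedMeasure, withDensity_apply _ MeasurableSet.univ, Measure.restrict_univ,
      lintegral_map hφ measurable_fst, ← ha, ← withDensity_smul _ hφ]
    rfl
  have e2 : normalizedMeasure ((γ.map Prod.snd).withDensity ψ) =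
      (γ.map Prod.snd).withDensity fun z => b⁻¹ * ψ z := by
    rw [normalizedMeasure, withDensity_apply _ MeasurableSet.univ, Measure.restrict_univ,
      lintegral_map hψ measurable_snd, ← hb, ← withDensity_smul _ hψ]
    rfl
  rw [e1, e2]
  refine (Wc_withDensity_le hM γ (hφ.const_mul _) (hψ.const_mul _) ?_ ?_).trans ?_
  · rw [lintegral_const_mul _ hφ', ENNReal.inv_mul_cancel hφ0 hφt]
  · rw [lintegral_const_mul _ hψ', ENNReal.inv_mul_cancel hψ0 hψt]
  have hab : a ≤ b + D := by
    rw [ha, hb, hD, ← lintegral_add_left hψ']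
    exact lintegral_mono hδ
  have h1 : ∫⁻ z, ENNReal.ofReal (c (dist z.1 z.2))
      ∂γ.withDensity (fun z => min (a⁻¹ * φ z.1) (b⁻¹ * ψ z.2)) ≤
      b⁻¹ * ∫⁻ z, ENNReal.ofReal (c (dist z.1 z.2)) ∂γ := by
    rw [← smul_eq_mul, ← lintegral_smul_measure, ← withDensity_const]
    refine lintegral_mono' (withDensity_mono (ae_of_all _ fun z => ?_)) le_rfl
    -- Choosing the second entry of the minimum leaves only the mass `b` of the second measure in
    -- the constant.
    exact (min_le_right _ _).trans (mul_le_of_le_one_right zero_le (hψ1 _))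
  have h2 : ∫⁻ z, (b⁻¹ * ψ z.2 - a⁻¹ * φ z.1) ∂γ ≤ b⁻¹ * (2 * D) := by
    calc ∫⁻ z, (b⁻¹ * ψ z.2 - a⁻¹ * φ z.1) ∂γ
        -- The error splits into a difference of normalizations and a difference of densities. The
        -- truncated subtraction disposes of the case `b ≥ a`; otherwise `a ≤ b + D` bounds the
        -- first part by `b⁻¹ * D`.
        ≤ ∫⁻ z, ((b⁻¹ - a⁻¹) * φ z.1 + b⁻¹ * δ z) ∂γ := by
          refine lintegral_mono fun z => tsub_le_iff_right.2 ?_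
          calc b⁻¹ * ψ z.2 ≤ b⁻¹ * (φ z.1 + δ z) := by gcongr; exact hδ' z
            _ = b⁻¹ * φ z.1 + b⁻¹ * δ z := mul_add _ _ _
            _ ≤ ((b⁻¹ - a⁻¹) + a⁻¹) * φ z.1 + b⁻¹ * δ z := by gcongr; exact le_tsub_add
            _ = _ := by ring
      _ = (b⁻¹ - a⁻¹) * a + b⁻¹ * D := by
          rw [lintegral_add_left (hφ'.const_mul _), lintegral_const_mul _ hφ',
            lintegral_const_mul _ hδm]
      _ ≤ b⁻¹ * D + b⁻¹ * D := by
          refine add_le_add ?_ le_rfl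
          rw [ENNReal.sub_mul fun _ _ => hφt, ENNReal.inv_mul_cancel hφ0 hφt]
          refine tsub_le_iff_right.2 ?_
          calc b⁻¹ * a ≤ b⁻¹ * (b + D) := by gcongr
            _ = b⁻¹ * D + 1 := by rw [mul_add, ENNReal.inv_mul_cancel hψ0 hψt, add_comm]
      _ = b⁻¹ * (2 * D) := by ring
  calc _ ≤ b⁻¹ * ∫⁻ z, ENNReal.ofReal (c (dist z.1 z.2)) ∂γ
        + ENNReal.ofReal M * (b⁻¹ * (2 * D)) := by gcongr
    _ = _ := by ring

/-- Transport costs do not increase under isometric embeddings. -/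
theorem Wc_map_le {c : ℝ → ℝ} (hc : IsCost c) {Z' : Type u} [MetricSpace Z'] [MeasurableSpace Z']
    [BorelSpace Z] [BorelSpace Z'] [TopologicalSpace.SeparableSpace Z']
    {h : Z → Z'} (hh : Isometry h) (μ ν : Measure Z) :
    Wc c (μ.map h) (ν.map h) ≤ Wc c μ ν := by
  have hm : Measurable h := hh.continuous.measurable
  refine le_iInf₂ fun γ hγ => ?_
  have hfst : (γ.map (Prod.map h h)).map Prod.fst = μ.map h := by
    rw [Measure.map_map measurable_fst (hm.prodMap hm), ← hγ.1, Measure.map_map hm measurable_fst]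
    rfl
  have hsnd : (γ.map (Prod.map h h)).map Prod.snd = ν.map h := by
    rw [Measure.map_map measurable_snd (hm.prodMap hm), ← hγ.2, Measure.map_map hm measurable_snd]
    rfl
  refine (iInf₂_le _ ⟨hfst, hsnd⟩).trans_eq ?_
  rw [lintegral_map hc.measurable_cost (hm.prodMap hm)]
  simp [hh.dist_eq]

end Coupling

/-! ### Gluing a sequence of metric spaces along a common subspace -/

/-- A metric space together with an isometric embedding of a given space `A`. -/
structure MetricExtension (A : Type u) [MetricSpace A] where
  Space : Type u
  metric : MetricSpace Space
  embed : A → Space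
  isom : Isometry embed

attribute [instance] MetricExtension.metric

section Gluing

variable {A : Type u} [MetricSpace A] [Nonempty A]

/-- The amalgam of two extensions of `A`. -/
noncomputable def MetricExtension.glue (Y W : MetricExtension A) : MetricExtension A where
  Space := Metric.GlueSpace Y.isom W.isom
  metric := inferInstance
  embed := Metric.toGlueL Y.isom W.isom ∘ Y.embed
  isom := (Metric.toGlueL_isometry _ _).comp Y.isom

/-- The amalgam of the first `n` extensions of a sequence. -/
noncomputable def MetricExtension.glueSeq (W : ℕ → MetricExtension A) : ℕ → MetricExtension A
  | 0 => ⟨A, inferInstance, id, isometry_id⟩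
  | n + 1 => (glueSeq W n).glue (W n)

/-- The inclusion of the first extension into the amalgam. -/
noncomputable def MetricExtension.inl (Y W : MetricExtension A) : Y.Space → (Y.glue W).Space :=
  Metric.toGlueL Y.isom W.isom

/-- The inclusion of the second extension into the amalgam. -/
noncomputable def MetricExtension.inr (Y W : MetricExtension A) : W.Space → (Y.glue W).Space :=
  Metric.toGlueR Y.isom W.isom

theorem MetricExtension.isometry_inl (Y W : MetricExtension A) : Isometry (Y.inl W) :=
  Metric.toGlueL_isometry _ _

theorem MetricExtension.isometry_inr (Y W : MetricExtension A) : Isometry (Y.inr W) :=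
  Metric.toGlueR_isometry _ _

theorem MetricExtension.inr_embed (Y W : MetricExtension A) (a : A) :
    Y.inr W (W.embed a) = (Y.glue W).embed a :=
  (congrFun (Metric.toGlue_commute Y.isom W.isom) a).symm

/-- Countably many extensions of `A` embed into a common complete metric space, compatibly with the
embeddings of `A`. -/
theorem MetricExtension.exists_complete (W : ℕ → MetricExtension A) :
    ∃ (Z : Type u) (_ : MetricSpace Z) (_ : CompleteSpace Z) (h : ∀ n, (W n).Space → Z) (j : A → Z),
      (∀ n, Isometry (h n)) ∧ Isometry j ∧ ∀ n a, h n ((W n).embed a) = j a := by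
  let Y := glueSeq W
  let s : ∀ n, (Y n).Space → (Y (n + 1)).Space := fun n => (Y n).inl (W n)
  have hs : ∀ n, Isometry (s n) := fun n => (Y n).isometry_inl (W n)
  let t : ∀ n, (W n).Space → (Y (n + 1)).Space := fun n => (Y n).inr (W n)
  have ht : ∀ n, Isometry (t n) := fun n => (Y n).isometry_inr (W n)
  have hst : ∀ n a, t n ((W n).embed a) = (Y (n + 1)).embed a := fun n a => (Y n).inr_embed (W n) a
  have hse : ∀ n a, s n ((Y n).embed a) = (Y (n + 1)).embed a := fun n a => rfl
  let ι : ∀ n, (Y n).Space → UniformSpace.Completion (Metric.InductiveLimit hs) :=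
    fun n y => (Metric.toInductiveLimit hs n y : UniformSpace.Completion _)
  have hι : ∀ n, Isometry (ι n) := fun n =>
    UniformSpace.Completion.coe_isometry.comp (Metric.toInductiveLimit_isometry hs n)
  have hιs : ∀ n y, ι (n + 1) (s n y) = ι n y := fun n y => by
    have := congrFun (Metric.toInductiveLimit_commute hs n) y
    exact congrArg (UniformSpace.Completion.coe' (α := Metric.InductiveLimit hs)) this
  -- Each bonding map preserves the copy of `A`, so all copies coincide in the limit.
  have hemb : ∀ n a, ι n ((Y n).embed a) = ι 0 ((Y 0).embed a) := by
    intro n a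
    induction n with
    | zero => rfl
    | succ n ih => rw [← hse, hιs, ih]
  refine ⟨_, inferInstance, inferInstance, fun n => ι (n + 1) ∘ t n, ι 0 ∘ (Y 0).embed,
    fun n => (hι _).comp (ht n), (hι 0).comp (Y 0).isom, fun n a => ?_⟩
  simp only [Function.comp_apply]
  rw [hst, hemb]

/-- Countably many separable extensions of `A` embed into a common complete separable metric space,
compatibly with the embeddings of `A`. -/
theorem MetricExtension.exists_complete_separable (W : ℕ → MetricExtension A)
    [∀ n, TopologicalSpace.SeparableSpace (W n).Space] :
    ∃ (Z : Type u) (_ : MetricSpace Z) (_ : CompleteSpace Z)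
      (_ : TopologicalSpace.SeparableSpace Z) (h : ∀ n, (W n).Space → Z) (j : A → Z),
      (∀ n, Isometry (h n)) ∧ Isometry j ∧ ∀ n a, h n ((W n).embed a) = j a := by
  obtain ⟨Z, _, _, h, j, hh, hj, hhj⟩ := exists_complete W
  -- The closed span of the images is complete and still separable.
  let C : Set Z := closure (⋃ n, range (h n))
  have hC : TopologicalSpace.IsSeparable C :=
    (TopologicalSpace.IsSeparable.iUnion fun n =>
      TopologicalSpace.isSeparable_range (hh n).continuous).closure
  have hmem : ∀ n x, h n x ∈ C := fun n x => subset_closure (mem_iUnion.2 ⟨n, x, rfl⟩)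
  have hjmem : ∀ a, j a ∈ C := fun a => hhj 0 a ▸ hmem 0 _
  exact ⟨C, inferInstance, isClosed_closure.completeSpace_coe, hC.separableSpace,
    fun n x => ⟨h n x, hmem n x⟩, fun a => ⟨j a, hjmem a⟩, fun n x y => hh n x y,
    fun x y => hj x y, fun n a => Subtype.ext (hhj n a)⟩

end Gluing

/-! ### Finiteness of the cuts -/

/-- The null set `S` supplied by `MemQR` need not be the singular set, so `B` may come close to it.
Off `V` the space is covered by countably many open sets of finite measure (Lindelöf). On each of
them `S` has open neighbourhoods of arbitrarily small measure. Together with `V` these form a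
neighbourhood of `S` whose trace on `B` has measure below `1`, and the rest of `B` is handled by the
finiteness on bounded sets away from `S`. -/
theorem MemQR.measure_lt_top {X : Type u} [MetricSpace X] [TopologicalSpace.SeparableSpace X]
    [MeasurableSpace X] [BorelSpace X] {m : Measure X} (hm : MemQR m) {B V : Set X}
    (hB : Bornology.IsBounded B) (hBm : MeasurableSet B) (hV : IsOpen V) (hSV : singularSet m ⊆ V)
    (hBV : Disjoint B V) : m B < ∞ := by
  have : SecondCountableTopology X := UniformSpace.secondCountable_of_separable X
  obtain ⟨-, S, -, -, -, hS0, hS⟩ := hm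
  have hU : ∀ x : ↥Vᶜ, ∃ U : Set X, IsOpen U ∧ x.1 ∈ U ∧ m U < ∞ := fun x => by
    have hx : x.1 ∉ singularSet m := fun h => x.2 (hSV h)
    simp only [singularSet, mem_ofPred_eq, not_forall] at hx
    obtain ⟨U, hU, hxU, hmU⟩ := hx
    exact ⟨U, hU, hxU, lt_top_iff_ne_top.2 hmU⟩
  choose U hUo hxU hUm using hU
  obtain ⟨T, hT, hTU⟩ := TopologicalSpace.isOpen_iUnion_countable U hUo
  have := hT.to_subtype
  obtain ⟨ε, hε, hεsum⟩ := ENNReal.exists_pos_sum_of_countable' one_ne_zero T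
  have hW : ∀ i : T, ∃ W : Set X, S ⊆ W ∧ IsOpen W ∧ m (W ∩ U i) < ε i := fun i => by
    have : IsFiniteMeasure (m.restrict (U i)) := ⟨by simpa using hUm i⟩
    have h0 : m.restrict (U i) S < ε i :=
      lt_of_le_of_lt (Measure.restrict_apply_le _ _) (hS0 ▸ hε i)
    obtain ⟨W, hSW, hWo, hW⟩ := S.exists_isOpen_lt_of_lt _ h0
    exact ⟨W, hSW, hWo, by rwa [Measure.restrict_apply hWo.measurableSet] at hW⟩
  choose W hSW hWo hWm using hW
  set N := V ∪ ⋃ i : T, W i ∩ U i with hN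
  have hNo : IsOpen N := hV.union (isOpen_iUnion fun i => (hWo i).inter (hUo i))
  have hSN : S ⊆ N := by
    intro x hx
    by_cases hxV : x ∈ V
    · exact Or.inl hxV
    · have : x ∈ ⋃ i ∈ T, U i := hTU ▸ mem_iUnion.2 ⟨⟨x, hxV⟩, hxU _⟩
      obtain ⟨i, hi, hxi⟩ := mem_iUnion₂.1 this
      exact Or.inr (mem_iUnion.2 ⟨⟨i, hi⟩, hSW _ hx, hxi⟩)
  have h1 : m (B ∩ Nᶜ) < ∞ := by
    have := (hS N (hNo.mem_nhdsSet.2 hSN) hNo.measurableSet).2 B hB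
    rwa [Measure.restrict_apply hBm] at this
  have h2 : m (B ∩ N) < ∞ := by
    have hsub : B ∩ N ⊆ ⋃ i : T, W i ∩ U i := by
      rintro x ⟨hxB, hxV | hx⟩
      · exact (hBV.le_bot ⟨hxB, hxV⟩).elim
      · exact hx
    calc m (B ∩ N) ≤ ∑' i : T, m (W i ∩ U i) := (measure_mono hsub).trans (measure_iUnion_le _)
      _ ≤ ∑' i, ε i := ENNReal.tsum_le_tsum fun i => (hWm i).le
      _ < ∞ := hεsum.trans ENNReal.one_lt_top
  calc m B ≤ m (B ∩ N) + m (B ∩ Nᶜ) := by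
        simpa [sdiff_eq] using measure_le_inter_add_sdiff m B N
    _ < ∞ := ENNReal.add_lt_top.2 ⟨h2, h1⟩

/-! ### Cut-off profiles -/

section Profile

variable {f : ℝ → ℝ} {Z : Type u} [MetricSpace Z]

open Classical in
/-- The cut-off density determined by a point `p` and a set `S`. -/
noncomputable def cutProfile (f : ℝ → ℝ) (k : ℕ) (p : Z) (S : Set Z) (z : Z) : ℝ :=
  if S.Nonempty then f (dist z p / 2 ^ k) * (1 - f (Metric.infDist z S * 2 ^ k))
  else f (dist z p / 2 ^ k)

theorem cutProfile_mem_Icc (hf : IsCutoff f) (k : ℕ) (p : Z) (S : Set Z) (z : Z) :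
    cutProfile f k p S z ∈ Icc (0 : ℝ) 1 := by
  have h1 := hf.mem_Icc (dist z p / 2 ^ k) (by positivity)
  have h2 := hf.mem_Icc (Metric.infDist z S * 2 ^ k)
    (mul_nonneg Metric.infDist_nonneg (by positivity))
  rw [cutProfile]
  split_ifs
  · exact ⟨mul_nonneg h1.1 (by linarith [h2.2]), mul_le_one₀ h1.2 (by linarith [h2.2])
      (by linarith [h2.1])⟩
  · exact h1

theorem continuous_cutProfile (hf : IsCutoff f) (k : ℕ) (p : Z) (S : Set Z) :
    Continuous (cutProfile f k p S) := by
  obtain ⟨K, hK⟩ := hf.lipschitz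
  have h1 : Continuous fun z => f (dist z p / 2 ^ k) :=
    hK.continuousOn.comp_continuous (by fun_prop) fun z => mem_Ici.2 (by positivity)
  have h2 : Continuous fun z => f (Metric.infDist z S * 2 ^ k) :=
    hK.continuousOn.comp_continuous ((Metric.continuous_infDist_pt S).mul continuous_const)
      fun z => mem_Ici.2 (mul_nonneg Metric.infDist_nonneg (by positivity))
  by_cases hS : S.Nonempty
  · have e : cutProfile f k p S =
        fun z => f (dist z p / 2 ^ k) * (1 - f (Metric.infDist z S * 2 ^ k)) :=
      funext fun z => if_pos hS
    exact e ▸ h1.mul (continuous_const.sub h2)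
  · have e : cutProfile f k p S = fun z => f (dist z p / 2 ^ k) := funext fun z => if_neg hS
    exact e ▸ h1

/-- This extends the density of a cut to the ambient space, where densities coming from different
spaces can be compared. -/
theorem Isometry.cutProfile_comp {Z' : Type u} [MetricSpace Z'] {i : Z → Z'} (hi : Isometry i)
    (k : ℕ) (p : Z) (S : Set Z) :
    cutProfile f k (i p) (i '' S) ∘ i = cutProfile f k p S := by
  funext z
  simp only [Function.comp_apply, cutProfile, hi.dist_eq, Metric.infDist_image hi]
  congr 1
  exact propext image_nonempty

/-- Where a profile does not vanish, all later profiles are equal to one. -/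
theorem cutProfile_eq_one (hf : IsCutoff f) {k l : ℕ} (hkl : k < l) {p : Z} {S : Set Z} {z : Z}
    (h : cutProfile f k p S z ≠ 0) : cutProfile f l p S z = 1 := by
  -- The strict inequality `k < l` gains the factor `2` that separates the regions `f = 1` and `f =
  -- 0`.
  have hpow : (2 : ℝ) * 2 ^ k ≤ 2 ^ l := by
    rw [← pow_succ']; exact pow_le_pow_right₀ one_le_two hkl
  have hk : (0 : ℝ) < 2 ^ k := by positivity
  have hl : (0 : ℝ) < 2 ^ l := by positivity
  have h1 : f (dist z p / 2 ^ k) ≠ 0 → f (dist z p / 2 ^ l) = 1 := fun h => by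
    have : dist z p / 2 ^ k < 2 := by
      by_contra! h2
      exact h (hf.eq_zero _ h2)
    rw [div_lt_iff₀ hk] at this
    exact hf.eq_one _ (by positivity) ((div_le_one hl).2 (by linarith))
  rw [cutProfile] at h ⊢
  split_ifs at h ⊢ with hS
  · have hd : 0 ≤ Metric.infDist z S := Metric.infDist_nonneg
    have h2 : 1 < Metric.infDist z S * 2 ^ k := by
      by_contra! h2
      exact h (by rw [hf.eq_one _ (by positivity) h2]; simp)
    have h3 : 2 ≤ Metric.infDist z S * 2 ^ l := by nlinarith
    rw [h1 (left_ne_zero_of_mul h), hf.eq_zero _ h3]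
    simp
  · exact h1 h

theorem exists_abs_cutProfile_sub_le (hf : IsCutoff f) (k : ℕ) : ∃ L : ℝ, 0 < L ∧
    ∀ {Z : Type u} [MetricSpace Z] (p q : Z) (S T : Set Z) (x y : Z),
      ENNReal.ofReal |cutProfile f k p S x - cutProfile f k q T y| ≤
        ENNReal.ofReal L * (edist x y + (edist p q + Metric.hausdorffEDist S T)) := by
  obtain ⟨K, hK⟩ := hf.lipschitz
  have hlip : ∀ s t : ℝ, 0 ≤ s → 0 ≤ t → |f s - f t| ≤ K * |s - t| := fun s t hs ht => by
    simpa only [Real.dist_eq] using hK.dist_le_mul s (mem_Ici.2 hs) t (mem_Ici.2 ht)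
  -- The extra `1` keeps the constant positive even if `K = 0`, so that its product with an infinite
  -- Hausdorff distance is infinite.
  refine ⟨K * (1 + 2 ^ k) + 1, by positivity, fun {Z} _ p q S T x y => ?_⟩
  have hL : (0 : ℝ) < K * (1 + 2 ^ k) + 1 := by positivity
  have hk : (1 : ℝ) ≤ 2 ^ k := one_le_pow₀ one_le_two
  -- When the Hausdorff distance is finite, `S` and `T` are both empty or both nonempty, so both
  -- profiles are given by the same formula.
  rcases eq_or_ne (Metric.hausdorffEDist S T) ∞ with htop | htop
  · rw [htop, add_top, add_top, ENNReal.mul_top (by simpa using hL)]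
    exact le_top
  set H := Metric.hausdorffDist S T with hH
  have hH0 : 0 ≤ H := Metric.hausdorffDist_nonneg
  have e : edist x y + (edist p q + Metric.hausdorffEDist S T) =
      ENNReal.ofReal (dist x y + (dist p q + H)) := by
    rw [ENNReal.ofReal_add dist_nonneg (by positivity), ENNReal.ofReal_add dist_nonneg hH0,
      edist_dist, edist_dist, hH, Metric.hausdorffDist, ENNReal.ofReal_toReal htop]
  rw [e, ← ENNReal.ofReal_mul hL.le]
  refine ENNReal.ofReal_le_ofReal ?_
  have hx := hf.mem_Icc (dist x p / 2 ^ k) (by positivity)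
  have hy := hf.mem_Icc (dist y q / 2 ^ k) (by positivity)
  have h1 : |f (dist x p / 2 ^ k) - f (dist y q / 2 ^ k)| ≤ K * (dist x y + dist p q) := by
    refine (hlip _ _ (by positivity) (by positivity)).trans ?_
    gcongr
    rw [← sub_div, abs_div, abs_of_pos (by positivity : (0 : ℝ) < 2 ^ k)]
    refine (div_le_self (abs_nonneg _) hk).trans ?_
    rw [← Real.dist_eq]
    exact dist_dist_dist_le x p y q
  have hxy : 0 ≤ dist x y := dist_nonneg
  have hpq : 0 ≤ dist p q := dist_nonneg
  have hK0 : (0 : ℝ) ≤ K := K.2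
  by_cases hS : S.Nonempty
  · have hT : T.Nonempty := Metric.nonempty_of_hausdorffEDist_ne_top hS htop
    have htop' : Metric.hausdorffEDist T S ≠ ∞ := by rwa [Metric.hausdorffEDist_comm]
    have hdS : 0 ≤ Metric.infDist x S := Metric.infDist_nonneg
    have hdT : 0 ≤ Metric.infDist y T := Metric.infDist_nonneg
    have h2 : |f (Metric.infDist x S * 2 ^ k) - f (Metric.infDist y T * 2 ^ k)| ≤
        K * (2 ^ k * (dist x y + H)) := by
      refine (hlip _ _ (by positivity) (by positivity)).trans ?_
      gcongr
      rw [← sub_mul, abs_mul, abs_of_pos (by positivity : (0 : ℝ) < 2 ^ k), mul_comm]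
      gcongr
      have a1 : Metric.infDist x S ≤ Metric.infDist y S + dist x y :=
        Metric.infDist_le_infDist_add_dist
      have a2 : Metric.infDist y S ≤ Metric.infDist y T + H := by
        rw [hH, Metric.hausdorffDist_comm]; exact Metric.infDist_le_infDist_add_hausdorffDist htop'
      have a3 : Metric.infDist y T ≤ Metric.infDist x T + dist y x :=
        Metric.infDist_le_infDist_add_dist
      have a4 : Metric.infDist x T ≤ Metric.infDist x S + H :=
        Metric.infDist_le_infDist_add_hausdorffDist htop
      rw [dist_comm y x] at a3
      rw [abs_le]
      constructor <;> linarith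
    have hx' := hf.mem_Icc (Metric.infDist x S * 2 ^ k) (by positivity)
    have hy' := hf.mem_Icc (Metric.infDist y T * 2 ^ k) (by positivity)
    simp only [cutProfile, hS, hT, if_true]
    generalize f (dist x p / 2 ^ k) = a at *
    generalize f (dist y q / 2 ^ k) = a' at *
    generalize f (Metric.infDist x S * 2 ^ k) = b at *
    generalize f (Metric.infDist y T * 2 ^ k) = b' at *
    calc |a * (1 - b) - a' * (1 - b')| = |(a - a') * (1 - b) - a' * (b - b')| := by
          congr 1; ring
      _ ≤ |a - a'| * |1 - b| + |a'| * |b - b'| := by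
          rw [← abs_mul, ← abs_mul]; exact abs_sub _ _
      _ ≤ |a - a'| * 1 + 1 * |b - b'| := by
          gcongr
          · rw [abs_le]; constructor <;> linarith [hx'.1, hx'.2]
          · rw [abs_le]; constructor <;> linarith [hy.1, hy.2]
      _ ≤ K * (dist x y + dist p q) + K * (2 ^ k * (dist x y + H)) := by linarith
      _ ≤ (K * (1 + 2 ^ k) + 1) * (dist x y + (dist p q + H)) := by
          have p1 : 0 ≤ K * H := by positivity
          have p2 : 0 ≤ K * (2 ^ k * dist p q) := by positivity
          linarith
  · have hT : ¬ T.Nonempty := fun hT => hS (Metric.nonempty_of_hausdorffEDist_ne_top hT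
      (by rwa [Metric.hausdorffEDist_comm]))
    simp only [cutProfile, hS, hT, if_false]
    have p1 : 0 ≤ K * H := by positivity
    have p2 : 0 ≤ K * (2 ^ k * (dist x y + (dist p q + H))) := by positivity
    linarith

end Profile

/-! ### Cuts -/

namespace PointedSpace

variable {f : ℝ → ℝ}

/-- The profile of the `k`-th cut as an extended nonnegative function. -/
noncomputable def density (f : ℝ → ℝ) (X : PointedSpace.{u}) (k : ℕ) (x : X) : ℝ≥0∞ :=
  ENNReal.ofReal (cutProfile f k X.base (singularSet X.measure) x)

theorem measure_cut (f : ℝ → ℝ) (X : PointedSpace.{u}) (k : ℕ) :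
    (X.cut f k).measure = X.measure.withDensity (X.density f k) := rfl

theorem measurable_density (hf : IsCutoff f) (X : PointedSpace.{u}) (k : ℕ) :
    Measurable (X.density f k) :=
  (continuous_cutProfile hf k X.base (singularSet X.measure)).measurable.ennreal_ofReal

theorem density_le_one (hf : IsCutoff f) (X : PointedSpace.{u}) (k : ℕ) (x : X) :
    X.density f k x ≤ 1 :=
  ENNReal.ofReal_le_one.2 (cutProfile_mem_Icc hf _ _ _ _).2

/-- The density is at most `1` and vanishes outside a bounded set that misses a neighbourhood of the
singular set. -/
theorem measure_cut_lt_top (hf : IsCutoff f) {X : PointedSpace.{u}} (hX : X.IsGeneralizedMMS)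
    (k : ℕ) : (X.cut f k).measure univ < ∞ := by
  let S := singularSet X.measure
  let B : Set X := {x | cutProfile f k X.base S x ≠ 0}
  let V : Set X := {x | S.Nonempty ∧ Metric.infDist x S * 2 ^ k < 1}
  have hV : IsOpen V := isOpen_const.inter
    (isOpen_lt ((Metric.continuous_infDist_pt S).mul continuous_const) continuous_const)
  have hBm : MeasurableSet B :=
    (isOpen_ne_fun (continuous_cutProfile hf k X.base S) continuous_const).measurableSet
  have hSV : S ⊆ V := fun x hx => ⟨⟨x, hx⟩, by simp [Metric.infDist_zero_of_mem hx]⟩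
  have hBV : Disjoint B V := by
    refine Set.disjoint_left.2 fun x hxB ⟨hS, hx⟩ => hxB ?_
    rw [cutProfile, if_pos hS,
      hf.eq_one _ (mul_nonneg Metric.infDist_nonneg (by positivity)) hx.le]
    simp
  have hB : Bornology.IsBounded B := by
    refine Metric.isBounded_ball (x := X.base) (r := 2 * 2 ^ k) |>.subset fun x hx => ?_
    rw [Metric.mem_ball, ← div_lt_iff₀ (by positivity)]
    by_contra! h
    refine hx ?_
    simp [cutProfile, hf.eq_zero _ h]
  refine lt_of_le_of_lt ?_ (hX.memQR.measure_lt_top hB hBm hV hSV hBV)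
  rw [measure_cut, withDensity_apply _ MeasurableSet.univ, Measure.restrict_univ,
    ← lintegral_indicator_one hBm]
  refine lintegral_mono fun x => ?_
  by_cases hx : x ∈ B
  · simpa [hx] using density_le_one hf X k x
  · have : cutProfile f k X.base S x = 0 := by simpa [B] using hx
    change ENNReal.ofReal (cutProfile f k X.base S x) ≤ _
    simp [this]

/-- The two densities multiply to the smaller one, so a later cut determines all earlier ones. -/
theorem measure_cut_of_lt (hf : IsCutoff f) (X : PointedSpace.{u}) {k l : ℕ} (hkl : k < l) :
    (X.cut f k).measure = (X.cut f l).measure.withDensity (X.density f k) := by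
  rw [measure_cut, measure_cut, ← withDensity_mul _ (X.measurable_density hf l)
    (X.measurable_density hf k)]
  congr 1
  funext x
  by_cases h : cutProfile f k X.base (singularSet X.measure) x = 0
  · simp [density, h]
  · simp [density, cutProfile_eq_one hf hkl h]

theorem MemClass.measure_cut_pos (hf : IsCutoff f) {X : PointedSpace.{u}} {kbar : ℕ}
    (hX : X.MemClass f kbar) {k : ℕ} (hk : kbar ≤ k) : 0 < (X.cut f k).measure univ := by
  rcases hk.eq_or_lt with rfl | hk
  · exact hX.2
  · refine hX.2.trans_le ?_
    rw [measure_cut_of_lt hf X hk]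
    refine (withDensity_mono (ae_of_all _ fun x => density_le_one hf X kbar x) univ).trans_eq ?_
    simp

end PointedSpace

/-! ### Comparison of cuts at different levels -/

section Normalization

variable {α β : Type*} [MeasurableSpace α] [MeasurableSpace β]

theorem normalizedMeasure_smul {r : ℝ≥0∞} (hr0 : r ≠ 0) (hr : r ≠ ∞) (μ : Measure α) :
    normalizedMeasure (r • μ) = normalizedMeasure μ := by
  rw [normalizedMeasure, normalizedMeasure, Measure.smul_apply, smul_eq_mul, smul_smul,
    ENNReal.mul_inv (Or.inl hr0) (Or.inl hr), mul_right_comm, ENNReal.inv_mul_cancel hr0 hr, one_mul]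

theorem map_normalizedMeasure (μ : Measure α) {i : α → β} (hi : Measurable i) :
    (normalizedMeasure μ).map i = normalizedMeasure (μ.map i) := by
  rw [normalizedMeasure, normalizedMeasure, Measure.map_smul, Measure.map_apply hi .univ,
    preimage_univ]

end Normalization

namespace PointedSpace

variable {f : ℝ → ℝ}

theorem normalized_cut_of_lt (hf : IsCutoff f) {X : PointedSpace.{u}} {kbar : ℕ}
    (hX : X.MemClass f kbar) {k l : ℕ} (hk : kbar ≤ l) (hkl : k < l) :
    (X.cut f k).normalized =
      normalizedMeasure ((X.cut f l).normalized.withDensity (X.density f k)) := by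
  have h0 := (hX.measure_cut_pos hf hk).ne'
  have ht := (measure_cut_lt_top hf hX.1 l).ne
  change normalizedMeasure (X.cut f k).measure = _
  rw [measure_cut_of_lt hf X hkl, normalized, withDensity_smul_measure,
    normalizedMeasure_smul (ENNReal.inv_ne_zero.2 ht) (ENNReal.inv_ne_top.2 h0)]

theorem normalized_cut_univ (hf : IsCutoff f) {X : PointedSpace.{u}} {kbar : ℕ}
    (hX : X.MemClass f kbar) {k : ℕ} (hk : kbar ≤ k) : (X.cut f k).normalized univ = 1 :=
  ENNReal.inv_mul_cancel (hX.measure_cut_pos hf hk).ne' (measure_cut_lt_top hf hX.1 k).ne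

theorem lintegral_density_ne_zero (hf : IsCutoff f) {X : PointedSpace.{u}} {kbar : ℕ}
    (hX : X.MemClass f kbar) {k l : ℕ} (hk : kbar ≤ k) (hkl : k < l) :
    ∫⁻ x, X.density f k x ∂(X.cut f l).normalized ≠ 0 := by
  have h0 := (hX.measure_cut_pos hf hk).ne'
  rw [measure_cut_of_lt hf X hkl, withDensity_apply _ .univ, Measure.restrict_univ] at h0
  rw [normalized, lintegral_smul_measure]
  exact mul_ne_zero (ENNReal.inv_ne_zero.2 (measure_cut_lt_top hf hX.1 l).ne) h0

theorem lintegral_density_ne_top (hf : IsCutoff f) {X : PointedSpace.{u}} {kbar : ℕ}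
    (hX : X.MemClass f kbar) (k : ℕ) {l : ℕ} (hl : kbar ≤ l) :
    ∫⁻ x, X.density f k x ∂(X.cut f l).normalized ≠ ∞ := by
  refine ne_top_of_le_ne_top ENNReal.one_ne_top ?_
  refine (lintegral_mono fun x => density_le_one hf X k x).trans ?_
  rw [lintegral_const, normalized_cut_univ hf hX hl, one_mul]

/-- The transport distance of the normalized `k`-th cuts is controlled by the one of the normalized
`l`-th cuts for `k < l`, with a constant depending only on the second space. -/
theorem exists_Wc_cut_le {c : ℝ → ℝ} (hf : IsCutoff f) (hc : IsCost c) {kbar : ℕ}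
    {Y : PointedSpace.{u}} (hY : Y.MemClass f kbar) {k l : ℕ} (hk : kbar ≤ k) (hkl : k < l) :
    ∃ C : ℝ≥0∞, C ≠ ∞ ∧ ∀ {X : PointedSpace.{u}}, X.MemClass f kbar →
      ∀ {Z : Type u} [MetricSpace Z] [TopologicalSpace.SeparableSpace Z] [MeasurableSpace Z]
        [BorelSpace Z] {i : X → Z} {j : Y → Z}, Isometry i → Isometry j →
        Wc c ((X.cut f k).normalized.map i) ((Y.cut f k).normalized.map j) ≤
          C * (Wc c ((X.cut f l).normalized.map i) ((Y.cut f l).normalized.map j) +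
            (edist (i X.base) (j Y.base) +
              Metric.hausdorffEDist (i '' singularSet X.measure) (j '' singularSet Y.measure))) := by
  obtain ⟨M, hM0, hM⟩ := hc.exists_bound
  obtain ⟨L, hL0, hL⟩ := exists_abs_cutProfile_sub_le hf k
  obtain ⟨K, hK0, hK⟩ := hc.exists_min_le L hL0.le
  set b := ∫⁻ x, Y.density f k x ∂(Y.cut f l).normalized with hb
  have hb0 : b ≠ 0 := lintegral_density_ne_zero hf hY hk hkl
  have hbt : b ≠ ∞ := lintegral_density_ne_top hf hY k (hk.trans hkl.le)
  set C := b⁻¹ * (1 + 2 * ENNReal.ofReal M * (ENNReal.ofReal K + ENNReal.ofReal L)) with hC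
  have hC0 : C ≠ 0 := mul_ne_zero (ENNReal.inv_ne_zero.2 hbt) (by simp)
  have hCt : C ≠ ∞ := by
    refine ENNReal.mul_ne_top (ENNReal.inv_ne_top.2 hb0) (ENNReal.add_ne_top.2 ⟨by simp, ?_⟩)
    exact ENNReal.mul_ne_top (ENNReal.mul_ne_top (by simp) (by simp))
      (ENNReal.add_ne_top.2 ⟨by simp, by simp⟩)
  refine ⟨C, hCt, fun {X} hX {Z} _ _ _ _ {i j} hi hj => ?_⟩
  set η := edist (i X.base) (j Y.base) +
    Metric.hausdorffEDist (i '' singularSet X.measure) (j '' singularSet Y.measure)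
  have him : Measurable i := hi.continuous.measurable
  have hjm : Measurable j := hj.continuous.measurable
  set Φ : Z → ℝ := cutProfile f k (i X.base) (i '' singularSet X.measure)
  set Ψ : Z → ℝ := cutProfile f k (j Y.base) (j '' singularSet Y.measure)
  set φ : Z → ℝ≥0∞ := fun z => ENNReal.ofReal (Φ z)
  set ψ : Z → ℝ≥0∞ := fun z => ENNReal.ofReal (Ψ z)
  have hφ : Measurable φ := (continuous_cutProfile hf k _ _).measurable.ennreal_ofReal
  have hψ : Measurable ψ := (continuous_cutProfile hf k _ _).measurable.ennreal_ofReal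
  have hφi : φ ∘ i = X.density f k :=
    funext fun x => congrArg ENNReal.ofReal (congrFun (hi.cutProfile_comp k _ _) x)
  have hψj : ψ ∘ j = Y.density f k :=
    funext fun x => congrArg ENNReal.ofReal (congrFun (hj.cutProfile_comp k _ _) x)
  have eX : (X.cut f k).normalized.map i =
      normalizedMeasure (((X.cut f l).normalized.map i).withDensity φ) := by
    rw [normalized_cut_of_lt hf hX (hk.trans hkl.le) hkl, map_normalizedMeasure _ him, ← hφi,
      map_withDensity_comp him hφ]
  have eY : (Y.cut f k).normalized.map j =
      normalizedMeasure (((Y.cut f l).normalized.map j).withDensity ψ) := by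
    rw [normalized_cut_of_lt hf hY (hk.trans hkl.le) hkl, map_normalizedMeasure _ hjm, ← hψj,
      map_withDensity_comp hjm hψ]
  have key : ∀ γ : Measure (Z × Z), γ.map Prod.fst = (X.cut f l).normalized.map i →
      γ.map Prod.snd = (Y.cut f l).normalized.map j →
      Wc c ((X.cut f k).normalized.map i) ((Y.cut f k).normalized.map j) ≤
        C * (∫⁻ z, ENNReal.ofReal (c (dist z.1 z.2)) ∂γ + η) := by
    intro γ h1 h2
    have hγ : γ univ = 1 := by
      rw [← preimage_univ (f := Prod.fst), ← Measure.map_apply measurable_fst .univ, h1,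
        Measure.map_apply him .univ, preimage_univ]
      exact normalized_cut_univ hf hX (hk.trans hkl.le)
    have : IsFiniteMeasure γ := ⟨by simp [hγ]⟩
    have hφγ : ∫⁻ z, φ z.1 ∂γ = ∫⁻ x, X.density f k x ∂(X.cut f l).normalized := by
      rw [← hφi, ← lintegral_map hφ measurable_fst, h1, lintegral_map hφ him]; rfl
    have hψγ : ∫⁻ z, ψ z.2 ∂γ = b := by
      rw [hb, ← hψj, ← lintegral_map hψ measurable_snd, h2, lintegral_map hψ hjm]; rfl
    -- This bounds the difference of the profiles: the Lipschitz term in the transport distance,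
    -- truncated at `1`, is absorbed by the cost. The displacement `η` of base points and singular
    -- sets enters linearly.
    set δ : Z × Z → ℝ≥0∞ := fun z =>
      ENNReal.ofReal K * ENNReal.ofReal (c (dist z.1 z.2)) + ENNReal.ofReal L * η
    have hδm : Measurable δ := (hc.measurable_cost.const_mul _).add measurable_const
    have habs : ∀ z : Z × Z, ENNReal.ofReal |Φ z.1 - Ψ z.2| ≤ δ z := by
      intro z
      have a1 : ENNReal.ofReal |Φ z.1 - Ψ z.2| ≤ 1 := by
        have hΦ := cutProfile_mem_Icc hf k (i X.base) (i '' singularSet X.measure) z.1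
        have hΨ := cutProfile_mem_Icc hf k (j Y.base) (j '' singularSet Y.measure) z.2
        refine ENNReal.ofReal_le_one.2 (abs_le.2 ⟨?_, ?_⟩) <;>
          linarith [hΦ.1, hΦ.2, hΨ.1, hΨ.2]
      have a2 := hL (i X.base) (j Y.base) (i '' singularSet X.measure) (j '' singularSet Y.measure)
        z.1 z.2
      rw [mul_add] at a2
      calc ENNReal.ofReal |Φ z.1 - Ψ z.2|
          ≤ min 1 (ENNReal.ofReal L * edist z.1 z.2 + ENNReal.ofReal L * η) := le_min a1 a2
        _ ≤ min 1 (ENNReal.ofReal L * edist z.1 z.2) + ENNReal.ofReal L * η := by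
          rw [← min_add_add_right]
          exact min_le_min_right _ le_self_add
        _ ≤ δ z := by
          refine add_le_add ?_ le_rfl
          rw [edist_dist, ← ENNReal.ofReal_mul hL0.le, ← ENNReal.ofReal_mul hK0,
            ← ENNReal.ofReal_one, ← ENNReal.ofReal_min]
          exact ENNReal.ofReal_le_ofReal (hK _ dist_nonneg)
    have hδ : ∀ z : Z × Z, φ z.1 ≤ ψ z.2 + δ z := fun z => by
      refine le_trans ?_ (add_le_add_right (habs z) _)
      refine (ENNReal.ofReal_le_ofReal ?_).trans ENNReal.ofReal_add_le
      linarith [le_abs_self (Φ z.1 - Ψ z.2)]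
    have hδ' : ∀ z : Z × Z, ψ z.2 ≤ φ z.1 + δ z := fun z => by
      refine le_trans ?_ (add_le_add_right (habs z) _)
      refine (ENNReal.ofReal_le_ofReal ?_).trans ENNReal.ofReal_add_le
      linarith [neg_abs_le (Φ z.1 - Ψ z.2)]
    have hψ1 : ∀ z, ψ z ≤ 1 := fun z =>
      ENNReal.ofReal_le_one.2 (cutProfile_mem_Icc hf _ _ _ _).2
    have main := Wc_normalizedMeasure_withDensity_le hM γ hφ hψ hψ1
      (hφγ ▸ lintegral_density_ne_zero hf hX hk hkl)
      (hφγ ▸ lintegral_density_ne_top hf hX k (hk.trans hkl.le))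
      (hψγ ▸ hb0) (hψγ ▸ hbt) hδ hδ' hδm
    rw [h1, h2, ← eX, ← eY, hψγ] at main
    refine main.trans ?_
    rw [lintegral_add_left (hc.measurable_cost.const_mul _), lintegral_const, hγ, mul_one,
      lintegral_const_mul _ hc.measurable_cost, hC, mul_assoc b⁻¹]
    generalize ∫⁻ z, ENNReal.ofReal (c (dist z.1 z.2)) ∂γ = E
    generalize ENNReal.ofReal M = M'
    generalize ENNReal.ofReal K = K'
    generalize ENNReal.ofReal L = L'
    refine mul_le_mul_right ?_ _
    -- The added terms complete the expression to a product with factor `E + η`.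
    calc E + 2 * M' * (K' * E + L' * η)
        ≤ E + 2 * M' * (K' * E + L' * η) + (η + 2 * M' * (K' * η + L' * E)) := le_self_add
      _ = _ := by ring
  -- The constant and `η` are moved to the left so that only the infimum over couplings remains on
  -- the right.
  rw [← ENNReal.div_le_iff' hC0 hCt, ← tsub_le_iff_right]
  refine le_iInf₂ fun γ hγ => ?_
  rw [tsub_le_iff_right, ENNReal.div_le_iff' hC0 hCt]
  exact key γ hγ.1 hγ.2

end PointedSpace

/-! ### Realizations -/

/-- Two spaces have isometric embeddings into a common separable space that almost realize their
distance. -/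
theorem exists_embeddingCost_le (c : ℝ → ℝ) (X Y : PointedSpace.{u}) {ε : ℝ≥0∞} (hε : ε ≠ 0) :
    ∃ (W : MetricExtension Y) (_ : TopologicalSpace.SeparableSpace W.Space)
      (_ : MeasurableSpace W.Space) (_ : BorelSpace W.Space) (i : X → W.Space),
      Isometry i ∧ embeddingCost c X Y i W.embed ≤ diKRWfm c X Y + ε := by
  -- For infinite distance any common space will do; the product contains both factors as slices
  -- through the base points.
  rcases eq_or_ne (diKRWfm c X Y) ∞ with htop | htop
  · have hi : Isometry fun x : X => (x, Y.base) := fun x y => by simp [Prod.edist_eq]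
    have hj : Isometry fun y : Y => (X.base, y) := fun x y => by simp [Prod.edist_eq]
    let W : MetricExtension Y := ⟨X × Y, inferInstance, fun y => (X.base, y), hj⟩
    have hW : TopologicalSpace.SeparableSpace W.Space :=
      inferInstanceAs (TopologicalSpace.SeparableSpace (X × Y))
    borelize W.Space
    refine ⟨W, hW, inferInstance, inferInstance, fun x => (x, Y.base), hi, ?_⟩
    rw [htop, top_add]
    exact le_top
  · have hlt := ENNReal.lt_add_right (ENNReal.add_ne_top.1 htop).2 hε
    simp only [iInf_lt_iff] at hlt
    obtain ⟨Z, hZ, -, hZs, hZm, hZb, i, j, hi, hj, h⟩ := hlt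
    refine ⟨⟨Z, hZ, j, hj⟩, hZs, hZm, hZb, i, hi, h.le.trans ?_⟩
    gcongr
    exact le_add_self

/-- The quantity that tends to zero along an effective realization. -/
noncomputable def realizationCost (f c : ℝ → ℝ) (k : ℕ) (X Y : PointedSpace.{u})
    {Z : Type u} [MetricSpace Z] [MeasurableSpace Z] (i : X → Z) (j : Y → Z) : ℝ≥0∞ :=
  (X.cut f k).logMassRatio (Y.cut f k) + edist (i X.base) (j Y.base)
    + Metric.hausdorffEDist (i '' singularSet X.measure) (j '' singularSet Y.measure)
    + Wc c ((X.cut f k).normalized.map i) ((Y.cut f k).normalized.map j)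

section Realization

variable {f c : ℝ → ℝ} {X Y : PointedSpace.{u}}

theorem realizationCost_eq (hX : X.IsCanonical) (hY : Y.IsCanonical) (k : ℕ) {Z : Type u}
    [MetricSpace Z] [MeasurableSpace Z] (i : X → Z) (j : Y → Z) :
    realizationCost f c k X Y i j =
      (X.cut f k).logMassRatio (Y.cut f k) + embeddingCost c (X.cut f k) (Y.cut f k) i j := by
  have hX' : X.distinguished = singularSet X.measure := hX
  have hY' : Y.distinguished = singularSet Y.measure := hY
  simp only [realizationCost, embeddingCost, PointedSpace.cut, hX', hY', add_assoc]

theorem diKRWfm_cut_le (hX : X.IsCanonical) (hY : Y.IsCanonical) (k : ℕ) {Z : Type u}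
    [hZ : MetricSpace Z] [hc : CompleteSpace Z] [hs : TopologicalSpace.SeparableSpace Z]
    [hm : MeasurableSpace Z] [hb : BorelSpace Z] {i : X → Z} {j : Y → Z} (hi : Isometry i)
    (hj : Isometry j) :
    diKRWfm c (X.cut f k) (Y.cut f k) ≤ realizationCost f c k X Y i j := by
  rw [realizationCost_eq hX hY, diKRWfm]
  refine add_le_add le_rfl ?_
  exact iInf_le_of_le Z <| iInf_le_of_le hZ <| iInf_le_of_le hc <| iInf_le_of_le hs <|
    iInf_le_of_le hm <| iInf_le_of_le hb <| iInf_le_of_le i <| iInf_le_of_le j <|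
    iInf_le_of_le hi <| iInf_le_of_le hj le_rfl

theorem realizationCost_comp_le (hc : IsCost c) (k : ℕ) {Z Z' : Type u} [MetricSpace Z]
    [MeasurableSpace Z] [BorelSpace Z] [MetricSpace Z'] [MeasurableSpace Z'] [BorelSpace Z']
    [TopologicalSpace.SeparableSpace Z'] {i : X → Z} {j : Y → Z} (hi : Isometry i)
    (hj : Isometry j) {h : Z → Z'} (hh : Isometry h) :
    realizationCost f c k X Y (h ∘ i) (h ∘ j) ≤ realizationCost f c k X Y i j := by
  have hhm : Measurable h := hh.continuous.measurable
  rw [realizationCost, realizationCost, image_comp, image_comp, Metric.hausdorffEDist_image hh,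
    ← Measure.map_map hhm hi.continuous.measurable, ← Measure.map_map hhm hj.continuous.measurable,
    Function.comp_apply, Function.comp_apply, hh.edist_eq]
  exact add_le_add le_rfl (Wc_map_le hc hh _ _)

/-- Embeddings that are good for a cut are good for all earlier cuts. -/
theorem exists_realizationCost_le (hf : IsCutoff f) (hc : IsCost c) {kbar : ℕ}
    (hY : Y.MemClass f kbar) (hYc : Y.IsCanonical) {k l : ℕ} (hk : kbar ≤ k) (hkl : k < l) :
    ∃ C : ℝ≥0∞, C ≠ ∞ ∧ ∀ {X : PointedSpace.{u}}, X.MemClass f kbar → X.IsCanonical →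
      ∀ {Z : Type u} [MetricSpace Z] [TopologicalSpace.SeparableSpace Z] [MeasurableSpace Z]
        [BorelSpace Z] {i : X → Z} {j : Y → Z}, Isometry i → Isometry j →
        realizationCost f c k X Y i j ≤ (X.cut f k).logMassRatio (Y.cut f k) +
          C * embeddingCost c (X.cut f l) (Y.cut f l) i j := by
  obtain ⟨C, hC, h⟩ := PointedSpace.exists_Wc_cut_le hf hc hY hk hkl
  -- The `1` pays for base points and singular sets, the `C` for the transport term.
  refine ⟨1 + C, by simp [hC], fun {X} hX hXc {Z} _ _ _ _ {i j} hi hj => ?_⟩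
  have h1 := h hX hi hj
  have hX' : X.distinguished = singularSet X.measure := hXc
  have hY' : Y.distinguished = singularSet Y.measure := hYc
  simp only [realizationCost, embeddingCost, hX', hY'] at h1 ⊢
  rw [add_assoc, add_assoc]
  refine add_le_add le_rfl ?_
  rw [← add_assoc, add_mul, one_mul]
  refine add_le_add le_self_add (h1.trans_eq ?_)
  rw [add_comm (Wc _ _ _)]

end Realization

/-! ### Convergence of the distances -/

/-- A single term of the series is at most the sum, and once `2 ^ k` times the sum is below `1` the
truncation is inactive. Conversely, dominated convergence for the counting measure applies with the
geometric majorant. -/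
theorem tendsto_diKRW_iff {f c : ℝ → ℝ} {kbar : ℕ} {X : ℕ → PointedSpace.{u}}
    {Y : PointedSpace.{u}} :
    Tendsto (fun n => diKRW f c kbar (X n) Y) atTop (𝓝 0) ↔
      ∀ k, kbar ≤ k → Tendsto (fun n => diKRWfm c ((X n).cut f k) (Y.cut f k)) atTop (𝓝 0) := by
  constructor
  · intro h k hk
    have h1 : ∀ n, min 1 (diKRWfm c ((X n).cut f k) (Y.cut f k)) ≤
        2 ^ k * diKRW f c kbar (X n) Y := fun n => by
      rw [← ENNReal.inv_mul_le_iff (by simp) (by simp)]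
      exact ENNReal.le_tsum (f := fun k : {k : ℕ // kbar ≤ k} => ((2 : ℝ≥0∞) ^ (k : ℕ))⁻¹ *
        min 1 (diKRWfm c ((X n).cut f k) (Y.cut f k))) ⟨k, hk⟩
    have h2 : Tendsto (fun n => 2 ^ k * diKRW f c kbar (X n) Y) atTop (𝓝 0) := by
      simpa using ENNReal.Tendsto.const_mul h (Or.inr (by simp : (2 : ℝ≥0∞) ^ k ≠ ∞))
    refine tendsto_of_tendsto_of_tendsto_of_le_of_le' tendsto_const_nhds h2
      (Eventually.of_forall fun _ => zero_le) ?_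
    filter_upwards [h2.eventually_lt_const one_pos] with n hn
    rcases min_le_iff.1 (h1 n) with h' | h'
    · exact absurd h' (not_le.2 hn)
    · exact h'
  · intro h
    let _ : MeasurableSpace {k : ℕ // kbar ≤ k} := ⊤
    have key := tendsto_lintegral_of_dominated_convergence (μ := Measure.count)
      (F := fun n (k : {k : ℕ // kbar ≤ k}) => ((2 : ℝ≥0∞) ^ (k : ℕ))⁻¹ *
        min 1 (diKRWfm c ((X n).cut f k) (Y.cut f k))) (f := fun _ => 0)
      (fun k => ((2 : ℝ≥0∞) ^ (k : ℕ))⁻¹) (fun n => measurable_from_top)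
      (fun n => ae_of_all _ fun k => mul_le_of_le_one_right zero_le (min_le_left _ _)) ?_ ?_
    · simpa only [lintegral_count, tsum_zero] using! key
    · rw [lintegral_count]
      refine ne_top_of_le_ne_top ?_ (ENNReal.tsum_comp_le_tsum_of_injective
        (f := Subtype.val) Subtype.val_injective fun k : ℕ => ((2 : ℝ≥0∞) ^ k)⁻¹)
      simp_rw [ENNReal.inv_pow, ENNReal.tsum_geometric]
      simp
    · refine ae_of_all _ fun k => ?_
      have h1 : Tendsto (fun n => min 1 (diKRWfm c ((X n).cut f k) (Y.cut f k))) atTop (𝓝 0) :=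
        tendsto_of_tendsto_of_tendsto_of_le_of_le tendsto_const_nhds (h k k.2)
          (fun _ => zero_le) fun _ => min_le_right _ _
      simpa using ENNReal.Tendsto.const_mul h1
        (Or.inr (by simp : ((2 : ℝ≥0∞) ^ (k : ℕ))⁻¹ ≠ ∞))

/-! ### Diagonal choice of embeddings and the equivalence -/

theorem Filter.exists_diagonal {P : ℕ → ℕ → Prop} (h0 : ∀ n, P 0 n)
    (h : ∀ k, ∀ᶠ n in atTop, P k n) :
    ∃ κ : ℕ → ℕ, Tendsto κ atTop atTop ∧ ∀ n, P (κ n) n := by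
  classical
  -- The largest admissible index up to `n` is taken; no monotonicity of `P` in its first argument
  -- is needed.
  refine ⟨fun n => Nat.findGreatest (fun k => P k n) n, tendsto_atTop.2 fun k => ?_, fun n => ?_⟩
  · filter_upwards [h k, eventually_ge_atTop k] with n hn hkn
    exact Nat.le_findGreatest hkn hn
  · exact Nat.findGreatest_spec (P := fun k => P k n) (Nat.zero_le n) (h0 n)

/-- Embeddings that are simultaneously good for more and more cuts. -/
theorem exists_extensions {f c : ℝ → ℝ} (hf : IsCutoff f) (hc : IsCost c) {kbar : ℕ}
    {X : ℕ → PointedSpace.{u}} {Y : PointedSpace.{u}} (hX : ∀ n, (X n).MemClass f kbar)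
    (hY : Y.MemClass f kbar) (hXc : ∀ n, (X n).IsCanonical) (hYc : Y.IsCanonical)
    (h : ∀ k, kbar ≤ k → Tendsto (fun n => diKRWfm c ((X n).cut f k) (Y.cut f k)) atTop (𝓝 0)) :
    ∃ κ : ℕ → ℕ, Tendsto κ atTop atTop ∧ ∀ n, ∃ (W : MetricExtension Y)
      (_ : TopologicalSpace.SeparableSpace W.Space) (_ : MeasurableSpace W.Space)
      (_ : BorelSpace W.Space) (i : X n → W.Space), Isometry i ∧ ∀ k, kbar ≤ k → k < κ n →
        realizationCost f c k (X n) Y i W.embed ≤ ((κ n : ℝ≥0∞) + 1)⁻¹ := by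
  refine Filter.exists_diagonal (P := fun K n => ∃ (W : MetricExtension Y)
      (_ : TopologicalSpace.SeparableSpace W.Space) (_ : MeasurableSpace W.Space)
      (_ : BorelSpace W.Space) (i : X n → W.Space), Isometry i ∧ ∀ k, kbar ≤ k → k < K →
        realizationCost f c k (X n) Y i W.embed ≤ ((K : ℝ≥0∞) + 1)⁻¹) (fun n => ?_) fun K => ?_
  · obtain ⟨W, hs, hm, hb, i, hi, -⟩ := exists_embeddingCost_le c (X n) Y one_ne_zero
    exact ⟨W, hs, hm, hb, i, hi, fun k _ hk => absurd hk (Nat.not_lt_zero k)⟩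
  -- The mass ratio does not depend on the embeddings, so it is controlled at level `k` directly.
  · have hlog : ∀ k, kbar ≤ k →
        Tendsto (fun n => ((X n).cut f k).logMassRatio (Y.cut f k)) atTop (𝓝 0) := fun k hk =>
      tendsto_of_tendsto_of_tendsto_of_le_of_le tendsto_const_nhds (h k hk)
        (fun _ => zero_le) fun _ => le_self_add
    -- A level strictly above all `k < K` at which convergence is assumed. The embeddings below
    -- realize the `l`-cut distance up to `1 / n`, which is `∞` for `n = 0`.
    set l := max K kbar
    have hW := fun n => exists_embeddingCost_le c ((X n).cut f l) (Y.cut f l)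
      (ENNReal.inv_ne_zero.2 (ENNReal.natCast_ne_top n))
    choose W hs hm hb i hi hWi using hW
    have hcost : Tendsto (fun n => embeddingCost c ((X n).cut f l) (Y.cut f l) (i n) (W n).embed)
        atTop (𝓝 0) := by
      refine tendsto_of_tendsto_of_tendsto_of_le_of_le tendsto_const_nhds ?_
        (fun _ => zero_le) hWi
      simpa using (h l (le_max_right _ _)).add ENNReal.tendsto_inv_nat_nhds_zero
    have hev : ∀ᶠ n in atTop, ∀ k ∈ Finset.range K, kbar ≤ k →
        realizationCost f c k (X n) Y (i n) (W n).embed ≤ ((K : ℝ≥0∞) + 1)⁻¹ := by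
      refine (Finset.eventually_all _).2 fun k hkK => ?_
      by_cases hk : kbar ≤ k
      · obtain ⟨C, hC, hle⟩ := exists_realizationCost_le hf hc hY hYc hk
          ((Finset.mem_range.1 hkK).trans_le (le_max_left K kbar))
        have ht : Tendsto (fun n => ((X n).cut f k).logMassRatio (Y.cut f k) +
            C * embeddingCost c ((X n).cut f l) (Y.cut f l) (i n) (W n).embed) atTop (𝓝 0) := by
          simpa using (hlog k hk).add (ENNReal.Tendsto.const_mul hcost (Or.inr hC))
        have hpos : (0 : ℝ≥0∞) < ((K : ℝ≥0∞) + 1)⁻¹ := ENNReal.inv_pos.2 (by simp)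
        filter_upwards [ht.eventually_lt_const hpos] with n hn _
        exact (hle (hX n) (hXc n) (hi n) (W n).isom).trans hn.le
      · exact Eventually.of_forall fun n hk' => absurd hk' hk
    filter_upwards [hev] with n hn
    exact ⟨W n, hs n, hm n, hb n, i n, hi n, fun k hk hkK => hn k (Finset.mem_range.2 hkK) hk⟩

theorem mainTheorem5 (f c : ℝ → ℝ) (hf : IsCutoff f) (hc : IsCost c) (kbar : ℕ)
    (X : ℕ → PointedSpace.{u}) (XInf : PointedSpace.{u})
    (hX : ∀ n, (X n).MemClass f kbar) (hXInf : XInf.MemClass f kbar)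
    (hS : ∀ n, (X n).IsCanonical) (hSInf : XInf.IsCanonical) :
    Tendsto (fun n => diKRW f c kbar (X n) XInf) atTop (𝓝 0) ↔
      ∃ (Z : Type u) (_ : MetricSpace Z) (_ : CompleteSpace Z)
        (_ : TopologicalSpace.SeparableSpace Z) (_ : MeasurableSpace Z) (_ : BorelSpace Z)
        (i : ∀ n, X n → Z) (iInf : XInf → Z),
        IsEffectiveRealization f c kbar X XInf i iInf := by
  rw [tendsto_diKRW_iff]
  constructor
  · intro h
    obtain ⟨κ, hκ, hW⟩ := exists_extensions hf hc hX hXInf hS hSInf h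
    choose W hs hm hb i hi hWi using hW
    have : Nonempty XInf := ⟨XInf.base⟩
    obtain ⟨Z, hZ, hZc, hZs, g, j, hg, hj, hgj⟩ := MetricExtension.exists_complete_separable W
    borelize Z
    refine ⟨Z, hZ, hZc, hZs, inferInstance, inferInstance, fun n => g n ∘ i n, j,
      fun n => (hg n).comp (hi n), hj, fun k hk => ?_⟩
    change Tendsto (fun n => realizationCost f c k (X n) XInf (g n ∘ i n) j) atTop (𝓝 0)
    have hbound : ∀ᶠ n in atTop, realizationCost f c k (X n) XInf (g n ∘ i n) j ≤
        ((κ n : ℝ≥0∞))⁻¹ := by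
      filter_upwards [hκ.eventually_gt_atTop k] with n hn
      -- Gluing along the limit space makes its embedding independent of `n`.
      have e : g n ∘ (W n).embed = j := funext fun a => hgj n a
      rw [← e]
      refine (realizationCost_comp_le hc k (hi n) (W n).isom (hg n)).trans ?_
      exact (hWi n k hk hn).trans (ENNReal.inv_le_inv.2 le_self_add)
    exact tendsto_of_tendsto_of_tendsto_of_le_of_le' tendsto_const_nhds
      (ENNReal.tendsto_inv_nat_nhds_zero.comp hκ) (Eventually.of_forall fun _ => zero_le) hbound
  · rintro ⟨Z, hZ, hZc, hZs, hZm, hZb, i, j, hi, hj, h⟩ k hk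
    exact tendsto_of_tendsto_of_tendsto_of_le_of_le tendsto_const_nhds (h k hk)
      (fun _ => zero_le) fun n => diKRWfm_cut_le (hS n) hSInf k (hi n) hj
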